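/- Let $p\equiv 1\pmod 4$ be a prime and write $p=c^2+d^2$ with $c,d\in\mathbb Z$ and $2\mid d$. Let $\left(\frac{\cdot}{\cdot}\right)$ denote the Legendre–Jacobi symbol; congruences modulo $p$ are between rational numbers whose denominators are not divisible by $p$. Let $b,m\in\mathbb Z$ with $\gcd(b,m)=1$ and $p\nmid m(b^2+4m^2)$. Then $$\left(\frac mp\right)\sum_{k=0}^{(p-1)/4}\binom{4k}{2k}\left(-\frac{b^2}{64m^2}\right)^k\equiv \begin{cases} \left(\dfrac{bc+2md}{b^2+4m^2}\right)\pmod p&\text{if }2\nmid b\text{ and }\left(\frac{b^2+4m^2}p\right)=1,\\[2mm] (-1)^{\frac{(\frac b2c+md)^2-1}8+\frac d2}\left(\dfrac{\frac b2c+md}{((\frac b2)^2+m^2)/2}\right)\pmod p&\text{if }2\mid b,\ 4\nmid b\text{ and }\left(\frac{b^2+4m^2}p\right)=1,\\[2mm] \left(\dfrac{mc-\frac b2d}{\frac{b^2}4+m^2}\right)\pmod p&\text{if }4\mid b\text{ and }\left(\frac{b^2+4m^2}p\right)=1,\\[2mm] 0\pmod p&\text{if }\left(\frac{b^2+4m^2}p\right)=-1,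 \end{cases}$$ and, if moreover $p\nmid b$, $$\left(\frac mp\right)\sum_{k=0}^{(p-1)/4}\binom{4k}{2k}\left(-\frac{b^2}{64m^2}\right)^k\equiv\left(\frac bp\right)\sum_{k=0}^{(p-1)/4}\binom{4k}{2k}\left(-\frac{m^2}{4b^2}\right)^k\pmod p.$$ In particular, for every $a\in\mathbb Z$ with $p\nmid 16a^2+1$, $$\sum_{k=0}^{(p-1)/4}\binom{4k}{2k}(-a^2)^k\equiv \begin{cases} \left(\dfrac{c-4ad}{16a^2+1}\right)\pmod p&\text{if }\left(\frac{16a^2+1}p\right)=1,\\[2mm] 0\pmod p&\text{if }\left(\frac{16a^2+1}p\right)=-1, \end{cases}$$ and, if moreover $p\nmid a$, $$\sum_{k=0}^{(p-1)/4}\binom{4k}{2k}(-a^2)^k\equiv\left(\frac{2a}p\right)\sum_{k=0}^{(p-1)/4}\binom{4k}{2k}\frac1{(-256a^2)^k}\pmod p.$$ -/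

import Mathlib

/-- The sum `∑_{k=0}^{(p-1)/4} C(4k,2k) x^k` modulo `p`. A congruence modulo `p` between rationals
with denominators prime to `p` is an equality in `ZMod p`. -/
def binomSum (p : ℕ) (x : ZMod p) : ZMod p :=
  ∑ k ∈ Finset.Icc 0 ((p - 1) / 4), (Nat.choose (4 * k) (2 * k) : ZMod p) * x ^ k

open scoped NumberTheorySymbols

/-! ### The binomial sum as a sum of two quadratic characters -/

/-! Let χ be the quadratic character mod p. As (p-1)/2 ≡ -1/2, the number C(2j,j) agrees mod p with
C((p-1)/2, j)(-4)^j; for j = 2k the sum at y² becomes the even part of a binomial expansion, so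
twice it is χ(1-4y) + χ(1+4y) (`two_mul_binomSum_sq`). Taking y = ib/(8m) with i² = -1, and using
that 2i = (1+i)² is a square, turns this into χ(b+2mi) + χ(b-2mi). The choice y = im/(2b) gives the
same value, whence the symmetry.

With i = d/c and χ(c) = 1, the two terms are χ(bc ± 2md), whose product is χ(b²+4m²): they cancel or
coincide. It remains to evaluate one of them. For N = uc+vd and w = ud-vc one has N²+w² = p(u²+v²),
so p(u²+v²) is a square mod N, and Jacobi reciprocity moves N from p to u²+v², or to its half at the
cost of (2/|N|) (`legendreSym_eq_jacobiSym_sq_add_sq`). The cases on b ensure that N is odd. -/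

theorem natCast_choose_two_mul_eq (p : ℕ) [Fact p.Prime] {n j : ℕ} (hn : p = 2 * n + 1)
    (hj : j ≤ n) :
    ((2 * j).choose j : ZMod p) = (n.choose j : ZMod p) * (-4) ^ j := by
  induction j with
  | zero => simp
  | succ j ih =>
    have ih := ih (by omega)
    have hne : ((j + 1 : ℕ) : ZMod p) ≠ 0 := by
      rw [Ne, ZMod.natCast_eq_zero_iff]
      exact fun h => absurd (Nat.le_of_dvd (by omega) h) (by omega)
    have h2n : (2 : ZMod p) * n + 1 = 0 := by
      have h : ((2 * n + 1 : ℕ) : ZMod p) = 0 := (ZMod.natCast_eq_zero_iff _ _).2 hn.dvd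
      exact_mod_cast h
    have h1 := congrArg (Nat.cast (R := ZMod p)) (Nat.succ_mul_centralBinom_succ j)
    have h2 := congrArg (Nat.cast (R := ZMod p)) (Nat.choose_succ_right_eq n j)
    simp only [Nat.centralBinom] at h1
    push_cast [Nat.cast_sub (show j ≤ n by omega)] at h1 h2 hne
    -- The ratios of consecutive terms agree: 2(2j+1) = -4(n-j), since 2n = -1 in `ZMod p`.
    apply mul_left_cancel₀ hne
    rw [h1, ih]
    linear_combination (-4 * (-4) ^ j) * (-h2) +
      2 * (n.choose j : ZMod p) * (-4) ^ j * h2n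

theorem two_mul_sum_choose_even {R : Type*} [CommRing R] (n : ℕ) (z : R) :
    2 * ∑ k ∈ Finset.range (n + 1), ((2 * n).choose (2 * k) : R) * z ^ (2 * k) =
      (1 - z) ^ (2 * n) + (1 + z) ^ (2 * n) := by
  -- Adding the expansions at z and -z kills the odd terms and doubles the even ones.
  have key : ∀ (f : ℕ → R) (n : ℕ),
      ∑ j ∈ Finset.range (2 * n + 1), (f j + (-1) ^ j * f j) =
        2 * ∑ k ∈ Finset.range (n + 1), f (2 * k) := by
    intro f n
    induction n with
    | zero => simp; ring
    | succ n ih =>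
      rw [show 2 * (n + 1) + 1 = 2 * n + 1 + 1 + 1 by ring, Finset.sum_range_succ,
        Finset.sum_range_succ, ih, Finset.sum_range_succ _ (n + 1)]
      simp only [pow_add, pow_mul, pow_one, neg_one_sq, one_pow,
        show 2 * n + 1 + 1 = 2 * (n + 1) by ring]
      ring
  rw [sub_eq_add_neg, add_comm 1 (-z), add_comm 1 z, add_pow, add_pow, ← Finset.sum_add_distrib,
    ← key fun j => ((2 * n).choose j : R) * z ^ j]
  refine Finset.sum_congr rfl fun j _ => ?_
  rw [neg_pow z j]
  ring

theorem two_mul_binomSum_sq (p : ℕ) [Fact p.Prime] (hp : p % 4 = 1) (y : ZMod p) :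
    2 * binomSum p (y ^ 2) = (1 - 4 * y) ^ (p / 2) + (1 + 4 * y) ^ (p / 2) := by
  obtain ⟨n, hn⟩ : ∃ n, p = 2 * (2 * n) + 1 := ⟨p / 4, by omega⟩
  have h2 : p / 2 = 2 * n := by omega
  have h4 : (p - 1) / 4 = n := by omega
  rw [h2, ← two_mul_sum_choose_even, binomSum, h4, ← Nat.range_succ_eq_Icc_zero]
  congr 1
  refine Finset.sum_congr rfl fun k hk => ?_
  have hk : k ≤ n := by simpa [Nat.lt_succ_iff] using hk
  have h := natCast_choose_two_mul_eq p (j := 2 * k) hn (by omega)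
  rw [show 4 * k = 2 * (2 * k) by ring, h, mul_pow, ← pow_mul, (even_two_mul k).neg_pow]
  ring

/-! ### Powers with exponent `p / 2` in `ZMod p` -/

theorem ZMod.sq_pow_half {p : ℕ} [Fact p.Prime] {x : ZMod p} (hx : x ≠ 0) :
    (x ^ 2) ^ (p / 2) = 1 := by
  rcases ZMod.pow_div_two_eq_neg_one_or_one p hx with h | h <;>
    rw [← pow_mul, mul_comm, pow_mul, h] <;> simp

theorem ZMod.two_ne_zero_of_mod_four {p : ℕ} [Fact p.Prime] (hp : p % 4 = 1) :
    (2 : ZMod p) ≠ 0 := by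
  have hp2 := (Fact.out : p.Prime).two_le
  intro h
  have h := Nat.le_of_dvd two_pos ((ZMod.natCast_eq_zero_iff 2 p).1 (by exact_mod_cast h))
  omega

theorem ZMod.neg_pow_half {p : ℕ} (hp : p % 4 = 1) (x : ZMod p) :
    (-x) ^ (p / 2) = x ^ (p / 2) :=
  Even.neg_pow ⟨p / 4, by omega⟩ x

/-- Since (1+i)² = 2i, the elements 2 and i differ by a square, up to a sign that is itself a
square. -/
theorem ZMod.two_pow_half {p : ℕ} [Fact p.Prime] (hp : p % 4 = 1) {i : ZMod p}
    (hi : i ^ 2 = -1) : (2 : ZMod p) ^ (p / 2) = i ^ (p / 2) := by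
  have h2 := ZMod.two_ne_zero_of_mod_four hp
  have h : (2 : ZMod p) = (1 + i) ^ 2 * -i := by linear_combination (i + 2) * hi
  have h1 : 1 + i ≠ 0 := by
    intro h0
    rw [h0] at h
    simp at h
    exact h2 h
  conv_lhs => rw [h]
  rw [mul_pow, ZMod.sq_pow_half h1, ZMod.neg_pow_half hp, one_mul]

theorem two_mul_pow_half_mul_binomSum {p : ℕ} [Fact p.Prime] (hp : p % 4 = 1) {i b m : ZMod p}
    (hi : i ^ 2 = -1) (hm : m ≠ 0) :
    2 * (m ^ (p / 2) * binomSum p (-(b ^ 2 / (64 * m ^ 2)))) =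
      (b + 2 * m * i) ^ (p / 2) + (b - 2 * m * i) ^ (p / 2) := by
  have h2 := ZMod.two_ne_zero_of_mod_four hp
  have h8 : (8 : ZMod p) ≠ 0 := by
    rw [show (8 : ZMod p) = 2 ^ 3 by norm_num]; exact pow_ne_zero _ h2
  have h64 : (64 : ZMod p) ≠ 0 := by
    rw [show (64 : ZMod p) = 2 ^ 6 by norm_num]; exact pow_ne_zero _ h2
  have hy : -(b ^ 2 / (64 * m ^ 2)) = (i * b / (8 * m)) ^ 2 := by
    field_simp
    rw [hi]; ring
  have hmul : ∀ z : ZMod p, m ^ (p / 2) * z ^ (p / 2) = (2 * m * i * z) ^ (p / 2) := by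
    intro z
    rw [mul_pow _ z, mul_pow _ i, ← ZMod.two_pow_half hp hi, mul_pow 2 m]
    linear_combination (-(m ^ (p / 2) * z ^ (p / 2))) *
      ((pow_right_comm 2 _ _).trans (ZMod.sq_pow_half h2) : ((2 : ZMod p) ^ (p / 2)) ^ 2 = 1)
  have e1 : 2 * m * i * (1 - 4 * (i * b / (8 * m))) = b + 2 * m * i := by
    have : 4 * (i * b / (8 * m)) = i * b / (2 * m) := by field_simp; ring
    rw [this]
    field_simp
    linear_combination (-b) * hi
  have e2 : 2 * m * i * (1 + 4 * (i * b / (8 * m))) = -(b - 2 * m * i) := by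
    have : 4 * (i * b / (8 * m)) = i * b / (2 * m) := by field_simp; ring
    rw [this]
    field_simp
    linear_combination b * hi
  rw [hy, mul_left_comm, two_mul_binomSum_sq p hp, mul_add, hmul, hmul, e1, e2,
    ZMod.neg_pow_half hp]

theorem two_mul_pow_half_mul_binomSum_inv {p : ℕ} [Fact p.Prime] (hp : p % 4 = 1)
    {i b m : ZMod p} (hi : i ^ 2 = -1) (hb : b ≠ 0) :
    2 * (b ^ (p / 2) * binomSum p (-(m ^ 2 / (4 * b ^ 2)))) =
      (b + 2 * m * i) ^ (p / 2) + (b - 2 * m * i) ^ (p / 2) := by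
  have h2 := ZMod.two_ne_zero_of_mod_four hp
  have h4 : (4 : ZMod p) ≠ 0 := by
    rw [show (4 : ZMod p) = 2 ^ 2 by norm_num]; exact pow_ne_zero _ h2
  have hy : -(m ^ 2 / (4 * b ^ 2)) = (i * m / (2 * b)) ^ 2 := by
    field_simp
    rw [hi]; ring
  have e : 4 * (i * m / (2 * b)) = 2 * m * i / b := by field_simp; ring
  rw [hy, mul_left_comm, two_mul_binomSum_sq p hp, mul_add, ← mul_pow, ← mul_pow, e, add_comm]
  congr 2 <;> field_simp

/-! ### Reciprocity for sums of two squares -/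

theorem jacobiSym_eq_of_mod_four_eq_one {n : ℕ} (hn : n % 4 = 1) {N : ℤ} (hN : Odd N) :
    J(N | n) = J(n | N.natAbs) := by
  have hodd : Odd n := Nat.odd_iff.2 (by omega)
  have h := jacobiSym.quadratic_reciprocity_one_mod_four' (Int.natAbs_odd.2 hN) hn
  rcases Int.natAbs_eq N with h0 | h0
  · conv_lhs => rw [h0]
    exact h
  · conv_lhs => rw [h0]
    rw [jacobiSym.neg _ hodd, ZMod.χ₄_nat_one_mod_four hn, one_mul, h]

/-- Modulo N the product rn is the unit square w², so r and n have the same symbol over |N|;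
reciprocity for n ≡ 1 mod 4 does the rest. -/
theorem jacobiSym_eq_of_mul_eq_sq_add_sq {n r : ℕ} (hn : n % 4 = 1) {N w : ℤ} (hN : Odd N)
    (hNw : IsCoprime N w) (h : (r * n : ℤ) = N ^ 2 + w ^ 2) :
    J(N | n) = J(r | N.natAbs) := by
  rw [jacobiSym_eq_of_mod_four_eq_one hn hN]
  have hgcd : w.gcd N.natAbs = 1 := by
    rw [← Int.isCoprime_iff_gcd_eq_one, Int.natCast_natAbs]
    exact hNw.symm.abs_right
  have h1 : J((r * n : ℤ) | N.natAbs) = 1 := by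
    rw [← jacobiSym.sq_one' hgcd]
    apply jacobiSym.mod_left'
    refine Int.ModEq.symm (Int.modEq_iff_dvd.2 ?_)
    rw [h, add_sub_cancel_right, Int.natAbs_dvd]
    exact dvd_pow_self N two_ne_zero
  rw [jacobiSym.mul_left] at h1
  rcases Int.mul_eq_one_iff_eq_one_or_neg_one.1 h1 with ⟨h2, h3⟩ | ⟨h2, h3⟩ <;> rw [h2, h3]

theorem odd_of_eq_sq_add_sq {p : ℕ} {c d : ℤ} (hp : p % 4 = 1)
    (hcd : (p : ℤ) = c ^ 2 + d ^ 2) (hd : 2 ∣ d) :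
    Odd c := by
  by_contra hc
  obtain ⟨k, rfl⟩ := even_iff_two_dvd.1 (Int.not_odd_iff_even.1 hc)
  obtain ⟨l, rfl⟩ := hd
  have : (p : ℤ) = 4 * (k ^ 2 + l ^ 2) := by rw [hcd]; ring
  omega

section SumTwoSquares

variable {p : ℕ} [Fact p.Prime] {c d : ℤ}

theorem not_dvd_of_eq_sq_add_sq (hcd : (p : ℤ) = c ^ 2 + d ^ 2) : ¬ (p : ℤ) ∣ c := by
  intro hc
  have hp : Prime (p : ℤ) := Nat.prime_iff_prime_int.1 Fact.out
  have hd : (p : ℤ) ∣ d :=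
    hp.dvd_of_dvd_pow (n := 2)
      ((Int.dvd_iff_dvd_of_dvd_add (by rw [← hcd])).1 (dvd_pow hc two_ne_zero))
  obtain ⟨k, rfl⟩ := hc
  obtain ⟨l, rfl⟩ := hd
  refine hp.not_isUnit (isUnit_of_dvd_one ⟨k ^ 2 + l ^ 2, ?_⟩)
  apply mul_left_cancel₀ hp.ne_zero
  linear_combination hcd

theorem isCoprime_of_not_dvd_sq_add_sq (hcd : (p : ℤ) = c ^ 2 + d ^ 2) {u v : ℤ}
    (huv : IsCoprime u v) (h : ¬ (p : ℤ) ∣ u ^ 2 + v ^ 2) :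
    IsCoprime (u * c + v * d) (u * d - v * c) := by
  have hp : Prime (p : ℤ) := Nat.prime_iff_prime_int.1 Fact.out
  have hN : ¬ (p : ℤ) ∣ u * c + v * d := by
    intro hN
    have h1 : (p : ℤ) ∣ c ^ 2 * (u ^ 2 + v ^ 2) := by
      have : c ^ 2 * (u ^ 2 + v ^ 2) = (u * c + v * d) * (u * c - v * d) + p * v ^ 2 := by
        rw [hcd]; ring
      rw [this]
      exact dvd_add (hN.mul_right _) (dvd_mul_right _ _)
    rcases hp.dvd_or_dvd h1 with h2 | h2
    · exact not_dvd_of_eq_sq_add_sq hcd (hp.dvd_of_dvd_pow h2)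
    · exact h h2
  obtain ⟨x, y, hxy⟩ := hp.coprime_iff_not_dvd.2 hN
  obtain ⟨s, t, hst⟩ := huv
  -- With N = uc+vd and w = ud-vc: cN+dw = pu and dN-cw = pv, so p = (sc+td)N + (sd-tc)w; substitute
  -- this in xp + yN = 1.
  refine ⟨y + x * (s * c + t * d), x * (s * d - t * c), ?_⟩
  rw [hcd] at hxy
  linear_combination hxy + x * (c ^ 2 + d ^ 2) * hst

theorem legendreSym_eq_jacobiSym_sq_add_sq (hp : p % 4 = 1) (hcd : (p : ℤ) = c ^ 2 + d ^ 2)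
    {u v : ℤ} (huv : IsCoprime u v) (h : ¬ (p : ℤ) ∣ u ^ 2 + v ^ 2) {r n : ℕ} (hn : n % 4 = 1)
    (hrn : (r * n : ℤ) = u ^ 2 + v ^ 2) (hodd : Odd (u * c + v * d)) :
    legendreSym p (u * c + v * d) =
      J(r | (u * c + v * d).natAbs) * J(u * c + v * d | n) := by
  have hcop := isCoprime_of_not_dvd_sq_add_sq hcd huv h
  have h1 := jacobiSym_eq_of_mul_eq_sq_add_sq (n := p * n) (r := r)
    (by rw [Nat.mul_mod, hp, hn]) hodd hcop
    (by push_cast; rw [mul_left_comm, hrn, hcd]; ring)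
  have hn0 : n ≠ 0 := by omega
  have hp0 : p ≠ 0 := by omega
  rw [jacobiSym.mul_right' _ hp0 hn0, ← jacobiSym.legendreSym.to_jacobiSym] at h1
  rw [← h1, mul_assoc, ← sq, jacobiSym.sq_one, mul_one]
  rw [← Int.isCoprime_iff_gcd_eq_one]
  -- N is prime to n because n divides N²+w² and N is prime to w.
  refine IsCoprime.of_isCoprime_of_dvd_right
    ((hcop.pow_right (n := 2)).add_mul_left_right (u * c + v * d)) ⟨r * p, ?_⟩
  rw [hcd]
  linear_combination -(c ^ 2 + d ^ 2) * hrn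

theorem legendreSym_eq_one_of_eq_sq_add_sq (hp : p % 4 = 1) (hcd : (p : ℤ) = c ^ 2 + d ^ 2)
    (hd : 2 ∣ d) : legendreSym p c = 1 := by
  have hprime : Prime (p : ℤ) := Nat.prime_iff_prime_int.1 Fact.out
  have h := legendreSym_eq_jacobiSym_sq_add_sq hp hcd (u := 1) (v := 0) isCoprime_one_left
    (by simpa using fun h => hprime.not_isUnit (isUnit_of_dvd_one h)) (r := 1) (n := 1) rfl
    (by norm_num) (by simpa using odd_of_eq_sq_add_sq hp hcd hd)
  simpa using h

/-- As c is odd, p ≡ 1 + 4(d/2)² mod 8. The sign is a power of a unit because d/2 may be negative.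
-/
theorem legendreSym_two_eq (hp : p % 4 = 1) (hcd : (p : ℤ) = c ^ 2 + d ^ 2) (hd : 2 ∣ d) :
    legendreSym p 2 = (((-1 : ℤˣ) ^ (d / 2) : ℤˣ) : ℤ) := by
  obtain ⟨k, rfl⟩ := odd_of_eq_sq_add_sq hp hcd hd
  obtain ⟨l, rfl⟩ := hd
  obtain ⟨t, ht⟩ := even_iff_two_dvd.1 (Int.even_mul_succ_self k)
  have hp8 : (p : ℤ) = 1 + 8 * t + 4 * l ^ 2 := by linear_combination hcd + 4 * ht
  rw [legendreSym.at_two (by omega), ZMod.χ₈_nat_eq_if_mod_eight,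
    Int.mul_ediv_cancel_left _ two_ne_zero, if_neg (by omega)]
  rcases Int.even_or_odd l with hl | hl
  · rw [hl.neg_one_zpow]
    obtain ⟨s, rfl⟩ := hl
    rw [if_pos (by left; ring_nf at hp8; omega)]
    simp
  · rw [hl.neg_one_zpow]
    obtain ⟨s, rfl⟩ := hl
    rw [if_neg (by ring_nf at hp8; omega)]
    simp

theorem jacobiSym_two_natAbs {N : ℤ} (hN : Odd N) :
    J(2 | N.natAbs) = (((-1 : ℤˣ) ^ ((N ^ 2 - 1) / 8) : ℤˣ) : ℤ) := by
  rw [jacobiSym.at_two (Int.natAbs_odd.2 hN), ZMod.χ₈_nat_eq_if_mod_eight]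
  have hN2 : N % 2 = 1 := Int.odd_iff.1 hN
  rw [if_neg (by omega)]
  obtain ⟨k, r, hk, hr⟩ : ∃ k r : ℤ, N = 8 * k + r ∧ (r = 1 ∨ r = 3 ∨ r = 5 ∨ r = 7) :=
    ⟨N / 8, N % 8, by omega, by omega⟩
  have hsq : (N ^ 2 - 1) / 8 = 2 * (4 * k ^ 2 + k * r) + (r ^ 2 - 1) / 8 := by
    rw [show N ^ 2 - 1 = (r ^ 2 - 1) + 8 * (2 * (4 * k ^ 2 + k * r)) by rw [hk]; ring,
      Int.add_mul_ediv_left _ _ (by norm_num)]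
    ring
  rw [hsq, zpow_add, (even_two_mul _).neg_one_zpow, one_mul]
  rcases hr with rfl | rfl | rfl | rfl
  · rw [if_pos (by omega)]; rfl
  · rw [if_neg (by omega)]; rfl
  · rw [if_neg (by omega)]; rfl
  · rw [if_pos (by omega)]; rfl

/-! ### The binomial sum through the characters of bc ± 2md -/

theorem exists_sq_eq_neg_one_of_eq_sq_add_sq (hcd : (p : ℤ) = c ^ 2 + d ^ 2) :
    ∃ i : ZMod p, i ^ 2 = -1 ∧ i * c = d ∧ i * d = -c := by
  have hc : (c : ZMod p) ≠ 0 := fun h =>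
    not_dvd_of_eq_sq_add_sq hcd ((ZMod.intCast_zmod_eq_zero_iff_dvd c p).1 h)
  have h : (c : ZMod p) ^ 2 + (d : ZMod p) ^ 2 = 0 := by
    have := congrArg (Int.cast (R := ZMod p)) hcd
    push_cast [ZMod.natCast_self] at this
    exact this.symm
  refine ⟨d / c, ?_, ?_, ?_⟩ <;> field_simp <;> linear_combination h

theorem two_mul_legendreSym_mul_binomSum (hp : p % 4 = 1) (hcd : (p : ℤ) = c ^ 2 + d ^ 2)
    (hd : 2 ∣ d) {b m : ℤ} (hm : ¬ (p : ℤ) ∣ m) :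
    2 * ((legendreSym p m : ZMod p) * binomSum p (-((b : ZMod p) ^ 2 / (64 * (m : ZMod p) ^ 2)))) =
      legendreSym p (b * c + 2 * m * d) + legendreSym p (b * c - 2 * m * d) := by
  obtain ⟨i, hi, hic, -⟩ := exists_sq_eq_neg_one_of_eq_sq_add_sq hcd
  have hm0 : (m : ZMod p) ≠ 0 := fun h => hm ((ZMod.intCast_zmod_eq_zero_iff_dvd m p).1 h)
  have hc : (c : ZMod p) ^ (p / 2) = 1 := by
    rw [← legendreSym.eq_pow, legendreSym_eq_one_of_eq_sq_add_sq hp hcd hd, Int.cast_one]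
  simp only [legendreSym.eq_pow]
  push_cast
  rw [two_mul_pow_half_mul_binomSum hp hi hm0, ← hic,
    ← mul_one ((_ + _ : ZMod p) ^ _), ← mul_one ((_ - _ : ZMod p) ^ _), ← hc, ← mul_pow, ← mul_pow]
  congr 2 <;> ring

theorem legendreSym_mul_legendreSym (hcd : (p : ℤ) = c ^ 2 + d ^ 2) (b m : ℤ) :
    legendreSym p (b * c + 2 * m * d) * legendreSym p (b * c - 2 * m * d) =
      legendreSym p (b ^ 2 + 4 * m ^ 2) := by
  have hc : (c : ZMod p) ≠ 0 := fun h =>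
    not_dvd_of_eq_sq_add_sq hcd ((ZMod.intCast_zmod_eq_zero_iff_dvd c p).1 h)
  rw [← one_mul (legendreSym p (b ^ 2 + _)), ← legendreSym.sq_one' p hc, ← legendreSym.mul,
    ← legendreSym.mul, legendreSym.mod, legendreSym.mod p (c ^ 2 * _)]
  congr 1
  -- c²(b²+4m²) - (b²c²-4m²d²) = 4m²(c²+d²).
  refine (Int.modEq_iff_dvd.2 ⟨4 * m ^ 2, ?_⟩ : _ ≡ _ [ZMOD p])
  rw [hcd]
  ring

theorem legendreSym_mul_binomSum_of_eq_one (hp : p % 4 = 1) (hcd : (p : ℤ) = c ^ 2 + d ^ 2)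
    (hd : 2 ∣ d) {b m : ℤ} (hm : ¬ (p : ℤ) ∣ m) (h : legendreSym p (b ^ 2 + 4 * m ^ 2) = 1) :
    (legendreSym p m : ZMod p) * binomSum p (-((b : ZMod p) ^ 2 / (64 * (m : ZMod p) ^ 2))) =
      legendreSym p (b * c + 2 * m * d) := by
  apply mul_left_cancel₀ (ZMod.two_ne_zero_of_mod_four hp)
  rw [two_mul_legendreSym_mul_binomSum hp hcd hd hm]
  rw [← legendreSym_mul_legendreSym hcd] at h
  rcases Int.mul_eq_one_iff_eq_one_or_neg_one.1 h with ⟨h2, h3⟩ | ⟨h2, h3⟩ <;>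
    rw [h2, h3, two_mul]

theorem legendreSym_mul_binomSum_of_eq_neg_one (hp : p % 4 = 1) (hcd : (p : ℤ) = c ^ 2 + d ^ 2)
    (hd : 2 ∣ d) {b m : ℤ} (hm : ¬ (p : ℤ) ∣ m) (h : legendreSym p (b ^ 2 + 4 * m ^ 2) = -1) :
    (legendreSym p m : ZMod p) * binomSum p (-((b : ZMod p) ^ 2 / (64 * (m : ZMod p) ^ 2))) =
      0 := by
  apply mul_left_cancel₀ (ZMod.two_ne_zero_of_mod_four hp)
  rw [two_mul_legendreSym_mul_binomSum hp hcd hd hm, mul_zero]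
  rw [← legendreSym_mul_legendreSym hcd] at h
  rcases Int.mul_eq_neg_one_iff_eq_one_or_neg_one.1 h with ⟨h2, h3⟩ | ⟨h2, h3⟩ <;>
    rw [h2, h3] <;> simp

theorem legendreSym_mul_binomSum_eq_inv (hp : p % 4 = 1) (hcd : (p : ℤ) = c ^ 2 + d ^ 2)
    {b m : ℤ} (hm : ¬ (p : ℤ) ∣ m) (hb : ¬ (p : ℤ) ∣ b) :
    (legendreSym p m : ZMod p) * binomSum p (-((b : ZMod p) ^ 2 / (64 * (m : ZMod p) ^ 2))) =
      (legendreSym p b : ZMod p) *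
        binomSum p (-((m : ZMod p) ^ 2 / (4 * (b : ZMod p) ^ 2))) := by
  obtain ⟨i, hi, -, -⟩ := exists_sq_eq_neg_one_of_eq_sq_add_sq hcd
  have hm0 : (m : ZMod p) ≠ 0 := fun h => hm ((ZMod.intCast_zmod_eq_zero_iff_dvd m p).1 h)
  have hb0 : (b : ZMod p) ≠ 0 := fun h => hb ((ZMod.intCast_zmod_eq_zero_iff_dvd b p).1 h)
  apply mul_left_cancel₀ (ZMod.two_ne_zero_of_mod_four hp)
  rw [legendreSym.eq_pow, legendreSym.eq_pow, two_mul_pow_half_mul_binomSum hp hi hm0,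
    two_mul_pow_half_mul_binomSum_inv hp hi hb0]

/-! ### Reciprocity according to the parities of u and v -/

theorem legendreSym_eq_jacobiSym_of_odd_of_even (hp : p % 4 = 1)
    (hcd : (p : ℤ) = c ^ 2 + d ^ 2) (hd : 2 ∣ d) {u v : ℤ} (hu : ¬ 2 ∣ u) (hv : 2 ∣ v)
    (huv : IsCoprime u v) (h : ¬ (p : ℤ) ∣ u ^ 2 + v ^ 2) :
    legendreSym p (u * c + v * d) = J(u * c + v * d | (u ^ 2 + v ^ 2).natAbs) := by
  have hu' : Odd u := by rwa [← Int.not_even_iff_odd, even_iff_two_dvd]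
  have hodd : Odd (u * c + v * d) :=
    (hu'.mul (odd_of_eq_sq_add_sq hp hcd hd)).add_even ((even_iff_two_dvd.2 hv).mul_right _)
  have habs : ((u ^ 2 + v ^ 2).natAbs : ℤ) = u ^ 2 + v ^ 2 := Int.natAbs_of_nonneg (by positivity)
  have hmod : (u ^ 2 + v ^ 2).natAbs % 4 = 1 := by
    have : (u ^ 2 + v ^ 2) % 4 = 1 := by
      obtain ⟨k, rfl⟩ := hu'
      obtain ⟨l, rfl⟩ := hv
      ring_nf
      omega
    omega
  rw [legendreSym_eq_jacobiSym_sq_add_sq hp hcd huv h (r := 1) hmod (by rw [habs]; simp) hodd]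
  simp

theorem legendreSym_eq_jacobiSym_of_odd_of_odd (hp : p % 4 = 1)
    (hcd : (p : ℤ) = c ^ 2 + d ^ 2) (hd : 2 ∣ d) {u v : ℤ} (hu : ¬ 2 ∣ u) (hv : ¬ 2 ∣ v)
    (huv : IsCoprime u v) (h : ¬ (p : ℤ) ∣ u ^ 2 + v ^ 2) :
    legendreSym p (u * c + v * d) =
      (((-1 : ℤˣ) ^ (((u * c + v * d) ^ 2 - 1) / 8) : ℤˣ) : ℤ) *
        J(u * c + v * d | ((u ^ 2 + v ^ 2) / 2).natAbs) := by
  have hu' : Odd u := by rwa [← Int.not_even_iff_odd, even_iff_two_dvd]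
  have hv' : Odd v := by rwa [← Int.not_even_iff_odd, even_iff_two_dvd]
  have hodd : Odd (u * c + v * d) :=
    (hu'.mul (odd_of_eq_sq_add_sq hp hcd hd)).add_even ((even_iff_two_dvd.2 hd).mul_left _)
  -- Odd squares are 1 mod 8, so half the sum is 1 mod 4 and reciprocity applies with r = 2.
  obtain ⟨t, ht⟩ : ∃ t : ℤ, u ^ 2 + v ^ 2 = 2 * (4 * t + 1) := by
    obtain ⟨k, rfl⟩ := hu'
    obtain ⟨l, rfl⟩ := hv'
    obtain ⟨s, hs⟩ := even_iff_two_dvd.1 (Int.even_mul_succ_self k)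
    obtain ⟨t, ht⟩ := even_iff_two_dvd.1 (Int.even_mul_succ_self l)
    exact ⟨s + t, by linear_combination 4 * hs + 4 * ht⟩
  have hpos : 0 ≤ u ^ 2 + v ^ 2 := by positivity
  rw [legendreSym_eq_jacobiSym_sq_add_sq hp hcd huv h (r := 2)
    (n := ((u ^ 2 + v ^ 2) / 2).natAbs) (by omega) (by omega) hodd, Nat.cast_ofNat,
    jacobiSym_two_natAbs hodd]

/-- The factor 2 has the character of i, and i(uc+vd) = ud-vc because ic = d and id = -c; the sign
is a square. -/
theorem legendreSym_two_mul_eq_swap (hp : p % 4 = 1) (hcd : (p : ℤ) = c ^ 2 + d ^ 2) (u v : ℤ) :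
    (legendreSym p (2 * (u * c + v * d)) : ZMod p) = legendreSym p (v * c + -u * d) := by
  obtain ⟨i, hi, hic, hid⟩ := exists_sq_eq_neg_one_of_eq_sq_add_sq hcd
  simp only [legendreSym.eq_pow]
  push_cast
  rw [mul_pow, ZMod.two_pow_half hp hi, ← mul_pow, ← ZMod.neg_pow_half hp (v * c + _)]
  congr 1
  linear_combination (u : ZMod p) * hic + v * hid

end SumTwoSquares

theorem theorem2p10 (p : ℕ) [Fact p.Prime] (hp : p % 4 = 1) (c d : ℤ)
    (hcd : (p : ℤ) = c ^ 2 + d ^ 2) (hd : 2 ∣ d) :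
    (∀ b m : ℤ, IsCoprime b m → ¬ (p : ℤ) ∣ m * (b ^ 2 + 4 * m ^ 2) →
      (¬ (p : ℤ) ∣ b →
        (legendreSym p m : ZMod p) * binomSum p (-((b : ZMod p) ^ 2 / (64 * (m : ZMod p) ^ 2))) =
          (legendreSym p b : ZMod p) *
            binomSum p (-((m : ZMod p) ^ 2 / (4 * (b : ZMod p) ^ 2)))) ∧
      (¬ 2 ∣ b → legendreSym p (b ^ 2 + 4 * m ^ 2) = 1 →
        (legendreSym p m : ZMod p) * binomSum p (-((b : ZMod p) ^ 2 / (64 * (m : ZMod p) ^ 2))) =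
          (jacobiSym (b * c + 2 * m * d) (b ^ 2 + 4 * m ^ 2).natAbs : ZMod p)) ∧
      (2 ∣ b → ¬ 4 ∣ b → legendreSym p (b ^ 2 + 4 * m ^ 2) = 1 →
        (legendreSym p m : ZMod p) * binomSum p (-((b : ZMod p) ^ 2 / (64 * (m : ZMod p) ^ 2))) =
          (((((-1 : ℤˣ) ^ (((b / 2 * c + m * d) ^ 2 - 1) / 8 + d / 2) : ℤˣ) : ℤ) *
            jacobiSym (b / 2 * c + m * d) (((b / 2) ^ 2 + m ^ 2) / 2).natAbs : ℤ) : ZMod p)) ∧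
      (4 ∣ b → legendreSym p (b ^ 2 + 4 * m ^ 2) = 1 →
        (legendreSym p m : ZMod p) * binomSum p (-((b : ZMod p) ^ 2 / (64 * (m : ZMod p) ^ 2))) =
          (jacobiSym (m * c - b / 2 * d) (b ^ 2 / 4 + m ^ 2).natAbs : ZMod p)) ∧
      (legendreSym p (b ^ 2 + 4 * m ^ 2) = -1 →
        (legendreSym p m : ZMod p) * binomSum p (-((b : ZMod p) ^ 2 / (64 * (m : ZMod p) ^ 2))) =
          0)) ∧
    (∀ a : ℤ, ¬ (p : ℤ) ∣ 16 * a ^ 2 + 1 →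
      (¬ (p : ℤ) ∣ a →
        binomSum p (-(a : ZMod p) ^ 2) =
          (legendreSym p (2 * a) : ZMod p) * binomSum p (1 / (-256 * (a : ZMod p) ^ 2))) ∧
      (legendreSym p (16 * a ^ 2 + 1) = 1 →
        binomSum p (-(a : ZMod p) ^ 2) =
          (jacobiSym (c - 4 * a * d) (16 * a ^ 2 + 1).natAbs : ZMod p)) ∧
      (legendreSym p (16 * a ^ 2 + 1) = -1 → binomSum p (-(a : ZMod p) ^ 2) = 0)) := by
  have hprime : Prime (p : ℤ) := Nat.prime_iff_prime_int.1 Fact.out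
  have h4 : ¬ (p : ℤ) ∣ 4 := fun h => by
    have h2 : (p : ℤ) ∣ 2 := hprime.dvd_of_dvd_pow (n := 2) (by simpa using h)
    exact ZMod.two_ne_zero_of_mod_four hp
      (by simpa using (ZMod.intCast_zmod_eq_zero_iff_dvd 2 p).2 h2)
  -- Here (b/2)c + md is even, out of reach of reciprocity. Trading the factor 2 for i gives mc -
  -- (b/2)d, which is odd.
  have hquad : ∀ b m : ℤ, IsCoprime b m → ¬ (p : ℤ) ∣ m * (b ^ 2 + 4 * m ^ 2) → 4 ∣ b →
      legendreSym p (b ^ 2 + 4 * m ^ 2) = 1 →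
        (legendreSym p m : ZMod p) * binomSum p (-((b : ZMod p) ^ 2 / (64 * (m : ZMod p) ^ 2))) =
          (jacobiSym (m * c - b / 2 * d) (b ^ 2 / 4 + m ^ 2).natAbs : ZMod p) := by
    rintro b m hbm hpm ⟨k, rfl⟩ h1
    have hm : ¬ (p : ℤ) ∣ m := fun h => hpm (h.mul_right _)
    have hm2 : ¬ 2 ∣ m := fun h => by
      have := hbm.isUnit_of_dvd' (x := 2) ⟨2 * k, by ring⟩ h
      norm_num [Int.isUnit_iff] at this
    rw [legendreSym_mul_binomSum_of_eq_one hp hcd hd hm h1,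
      show 4 * k * c + 2 * m * d = 2 * (2 * k * c + m * d) by ring,
      legendreSym_two_mul_eq_swap hp hcd,
      legendreSym_eq_jacobiSym_of_odd_of_even hp hcd hd hm2 ⟨-k, by ring⟩
        (hbm.symm.of_isCoprime_of_dvd_right ⟨-2, by ring⟩)
        fun h => hpm (dvd_mul_of_dvd_right (h.trans ⟨4, by ring⟩) _),
      show 4 * k / 2 = 2 * k by omega,
      show (4 * k) ^ 2 / 4 = (2 * k) ^ 2 by
        rw [show (4 * k) ^ 2 = 4 * (2 * k) ^ 2 by ring]; omega,
      show m * c + -(2 * k) * d = m * c - 2 * k * d by ring,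
      show m ^ 2 + (-(2 * k)) ^ 2 = (2 * k) ^ 2 + m ^ 2 by ring]
  refine ⟨fun b m hbm hpm => ?_, fun a ha => ?_⟩
  · have hm : ¬ (p : ℤ) ∣ m := fun h => hpm (h.mul_right _)
    refine ⟨legendreSym_mul_binomSum_eq_inv hp hcd hm, fun hb h1 => ?_, fun hb hb4 h1 => ?_,
      hquad b m hbm hpm, legendreSym_mul_binomSum_of_eq_neg_one hp hcd hd hm⟩
    · have hb2 : IsCoprime b 2 := by
        obtain ⟨k, hk⟩ : Odd b := by rwa [← Int.not_even_iff_odd, even_iff_two_dvd]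
        exact ⟨1, -k, by rw [hk]; ring⟩
      rw [legendreSym_mul_binomSum_of_eq_one hp hcd hd hm h1,
        legendreSym_eq_jacobiSym_of_odd_of_even hp hcd hd hb (dvd_mul_right 2 m)
          (hb2.mul_right hbm) fun h => hpm (dvd_mul_of_dvd_right (h.trans ⟨1, by ring⟩) _),
        show (2 * m) ^ 2 = 4 * m ^ 2 by ring]
    · obtain ⟨k, rfl⟩ := hb
      have hm2 : ¬ 2 ∣ m := fun h => by
        have := hbm.isUnit_of_dvd' (dvd_mul_right 2 k) h
        norm_num [Int.isUnit_iff] at this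
      rw [legendreSym_mul_binomSum_of_eq_one hp hcd hd hm h1,
        Int.mul_ediv_cancel_left _ two_ne_zero,
        show 2 * k * c + 2 * m * d = 2 * (k * c + m * d) by ring, legendreSym.mul,
        legendreSym_two_eq hp hcd hd,
        legendreSym_eq_jacobiSym_of_odd_of_odd hp hcd hd (by omega) hm2
          (hbm.of_isCoprime_of_dvd_left (dvd_mul_left k 2))
          fun h => hpm (dvd_mul_of_dvd_right (h.trans ⟨4, by ring⟩) _),
        zpow_add, Units.val_mul]
      congr 1
      ring
  · have h2 := ZMod.two_ne_zero_of_mod_four hp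
    have h64 : (64 : ZMod p) ≠ 0 := by
      rw [show (64 : ZMod p) = 2 ^ 6 by norm_num]; exact pow_ne_zero _ h2
    have hp1 : ¬ (p : ℤ) ∣ 1 := fun h => hprime.not_isUnit (isUnit_of_dvd_one h)
    -- The statements about a are the case b = 8a, m = 1, where 4 ∣ b.
    have hx : -(a : ZMod p) ^ 2 =
        -(((8 * a : ℤ) : ZMod p) ^ 2 / (64 * ((1 : ℤ) : ZMod p) ^ 2)) := by
      push_cast
      field_simp
      ring
    have hone : (legendreSym p 1 : ZMod p) = 1 := by simp
    have hB : (8 * a) ^ 2 + 4 * 1 ^ 2 = 2 ^ 2 * (16 * a ^ 2 + 1) := by ring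
    have hL : legendreSym p ((8 * a) ^ 2 + 4 * 1 ^ 2) = legendreSym p (16 * a ^ 2 + 1) := by
      rw [hB, legendreSym.mul, legendreSym.sq_one' p (by simpa using h2), one_mul]
    have hdvd : ¬ (p : ℤ) ∣ 1 * ((8 * a) ^ 2 + 4 * 1 ^ 2) := by
      rw [one_mul, hB]
      intro h
      rcases hprime.dvd_or_dvd h with h | h
      · exact h4 (by simpa using h)
      · exact ha h
    refine ⟨fun hpa => ?_, fun h1 => ?_, fun h1 => ?_⟩
    · have h8 : ¬ (p : ℤ) ∣ 8 * a := fun h => by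
        rcases hprime.dvd_or_dvd h with h | h
        · exact h4 ((hprime.dvd_of_dvd_pow (n := 3) (a := 2) (by simpa using h)).trans
            ⟨2, by norm_num⟩)
        · exact hpa h
      have h := legendreSym_mul_binomSum_eq_inv hp hcd (b := 8 * a) (m := 1) hp1 h8
      rw [← hx, hone, one_mul, show 8 * a = 2 ^ 2 * (2 * a) by ring, legendreSym.mul,
        legendreSym.sq_one' p (by simpa using h2), one_mul] at h
      rw [h]
      congr 2
      push_cast
      rw [neg_mul, one_div, inv_neg, one_pow, one_div]
      congr 2
      ring
    · have h := hquad (8 * a) 1 isCoprime_one_right hdvd ⟨2 * a, by ring⟩ (hL.trans h1)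
      rw [← hx, hone, one_mul, show 8 * a / 2 = 4 * a by omega,
        show (8 * a) ^ 2 / 4 = 16 * a ^ 2 by
          rw [show (8 * a) ^ 2 = 4 * (16 * a ^ 2) by ring]; omega, one_mul, one_pow] at h
      exact h
    · have h := legendreSym_mul_binomSum_of_eq_neg_one hp hcd hd hp1 (hL.trans h1)
      rwa [← hx, hone, one_mul] at h
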